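/- **Setting.** Let $\mathcal Y=\mathbb R^d$ with its Euclidean structure, let $G$ be a group (for instance a Lie group acting smoothly) acting on $\mathcal Y$ by linear isometries, let $\mathbb D\subset\mathcal Y$ be a finite dataset, and put $G(\mathbb D)=\{g z : g\in G,\ z\in\mathbb D\}$. Assume that every $y\in\mathcal Y$ has a nearest point in $G(\mathbb D)$, i.e. $\min_{z\in G(\mathbb D)}\|y-z\|$ is attained. (If $\mathbb D$ lies on a submanifold $\Omega\subset\mathcal Y$ preserved by $G$, then $G(\mathbb D)\subset\Omega$.) *Noise schedule.* Let $T>0$, let $\alpha:[0,T]\to[0,1]$ be continuous with $\alpha_0=1$ and $0<\alpha_t<1$ for $0<t<T$, and let $\gamma:(0,T)\to\mathbb R$ satisfy $\dot\alpha_t=-2\gamma_t\alpha_t$ on $(0,T)$. *Model.* Let $f:\mathcal Y\times(0,T)\to\mathcal Y$ be a continuous score model, equivariant under $G$: $f(gy,t)=g f(y,t)$. It is called *trained* if, among all continuous $G$-equivariant models, it is a global minimum of the training objective $$\mathcal L(f)=\mathbb E_{t\sim U[0,T],\ z\sim U(\mathbb D),\ \eta\sim\mathcal N(0,I)}\bigl\|-\sqrt{1-\alpha_t}\,f(\sqrt{\alpha_t}z+\sqrt{1-\alpha_t}\,\eta,\,t)-\eta\bigr\|^2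 .$$ *Denoising.* A denoising trajectory is a continuous $y:(0,T]\to\mathcal Y$, with arbitrary initial point $y_T$, such that $\partial_t y_t=-\gamma_t\,(y_t+f(y_t,t))$ on $(0,T)$. It ends at $p$ if $y_t\to p$ as $t\to0^+$. The prediction space $\Omega_f$ is the set of all endpoints of denoising trajectories. A trajectory is *regular* if $\partial_t y_t$ is bounded on $(0,T)$ and $y_t$ converges, as $t\to 0^+$, to a point that has a unique nearest point in $G(\mathbb D)$. **Theorem.** 1. If $f$ is trained, then every regular denoising trajectory ends at a point of $G(\mathbb D)$. 2. If every $z\in\mathbb D$ is a fixed point of the denoising flow, i.e. $z+f(z,t)=0$ for all $t\in(0,T)$, then every point of $G(\mathbb D)$ is the endpoint of a denoising trajectory (whether or not $f$ is trained). 3. Consequently, if $f$ is trained, all denoising trajectories are regular, and every $z\in\mathbb D$ is a fixed point of the denoising flow, then $\Omega_f=G(\mathbb D)$. 4. More generally, if $f$ is trained and every $z\in\mathbb D$ is the endpoint of some regular denoising trajectory, then the set of endpoints of regular denoising trajectories is exactly $G(\mathbb D)$. -/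

import Mathlib

open Set Filter Topology MeasureTheory ProbabilityTheory
open scoped ENNReal

noncomputable section

namespace Diffusion

/-- A variance-preserving noise schedule on `[0, T]`. Data are shrunk by `√α t` and blurred by
Gaussian noise of variance `1 - α t`; there is no noise at time `0`. The rate `γ` is the one of the
forward process `dy = -γ y dt + √(2 γ) dW`, whose marginals have these parameters exactly when
`α' = -2 γ α`. The rate may blow up at `T`, so that `α T = 0` is allowed. -/
structure NoiseSchedule where
  T : ℝ
  α : ℝ → ℝ
  γ : ℝ → ℝ
  T_pos : 0 < T
  α_cont : ContinuousOn α (Icc 0 T)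
  α_zero : α 0 = 1
  α_mem : ∀ t ∈ Ioo 0 T, α t ∈ Ioo (0 : ℝ) 1
  α_deriv : ∀ t ∈ Ioo 0 T, HasDerivAt α (-2 * γ t * α t) t

variable {d : ℕ} {G : Type*} [Group G]

/-- The augmented dataset `G(D) = {g z | g ∈ G, z ∈ D}`, for `G` acting by linear isometries. -/
def orbitSet (ρ : G →* (EuclideanSpace ℝ (Fin d) ≃ₗᵢ[ℝ] EuclideanSpace ℝ (Fin d)))
    (D : Finset (EuclideanSpace ℝ (Fin d))) : Set (EuclideanSpace ℝ (Fin d)) :=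
  {p | ∃ g : G, ∃ z ∈ D, p = ρ g z}

/-- `z` is a nearest point to `y` in `O`. -/
def IsNearest (O : Set (EuclideanSpace ℝ (Fin d))) (y z : EuclideanSpace ℝ (Fin d)) : Prop :=
  z ∈ O ∧ ∀ w ∈ O, dist y z ≤ dist y w

/-- A score model `f (y, t)`, continuous for `0 < t < T` and equivariant under `G`. (Scores blow up
at time `0`, so nothing is asked there.) -/
structure IsEquivariantModel (S : NoiseSchedule)
    (ρ : G →* (EuclideanSpace ℝ (Fin d) ≃ₗᵢ[ℝ] EuclideanSpace ℝ (Fin d)))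
    (f : EuclideanSpace ℝ (Fin d) → ℝ → EuclideanSpace ℝ (Fin d)) : Prop where
  cont : ContinuousOn (fun q : EuclideanSpace ℝ (Fin d) × ℝ => f q.1 q.2) (univ ×ˢ Ioo 0 S.T)
  equivariant : ∀ t ∈ Ioo 0 S.T, ∀ (g : G) (y : EuclideanSpace ℝ (Fin d)),
    f (ρ g y) t = ρ g (f y t)

/-- The training loss `𝔼 ‖ε(√α_t z + √(1-α_t) η, t) - η‖²`, with `t` uniform on `[0, T]`, `z`
uniform on the dataset `D` and `η` standard Gaussian, where `ε(y, t) = -√(1-α_t) f(y, t)` is the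
noise prediction of the score model `f`. -/
def trainingLoss (S : NoiseSchedule) (D : Finset (EuclideanSpace ℝ (Fin d)))
    (f : EuclideanSpace ℝ (Fin d) → ℝ → EuclideanSpace ℝ (Fin d)) : ℝ≥0∞ :=
  (ENNReal.ofReal S.T)⁻¹ * ∫⁻ t in Icc 0 S.T,
    (D.card : ℝ≥0∞)⁻¹ * ∑ z ∈ D, ∫⁻ η,
      ‖-(√(1 - S.α t) • f (√(S.α t) • z + √(1 - S.α t) • η) t) - η‖ₑ ^ 2
        ∂(stdGaussian (EuclideanSpace ℝ (Fin d)))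

/-- `f` is a trained equivariant model: a global minimum of the training loss among all
equivariant models. -/
def IsTrained (S : NoiseSchedule)
    (ρ : G →* (EuclideanSpace ℝ (Fin d) ≃ₗᵢ[ℝ] EuclideanSpace ℝ (Fin d)))
    (D : Finset (EuclideanSpace ℝ (Fin d)))
    (f : EuclideanSpace ℝ (Fin d) → ℝ → EuclideanSpace ℝ (Fin d)) : Prop :=
  IsEquivariantModel S ρ f ∧
    ∀ f', IsEquivariantModel S ρ f' → trainingLoss S D f ≤ trainingLoss S D f'

/-- A denoising trajectory: a solution of `∂ₜ y = -γ (y + f(y, t))`, run from time `T` down to time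
`0`. The initial point `y T` is arbitrary: the Gaussian from which it is drawn has full support. -/
structure IsTrajectory (S : NoiseSchedule)
    (f : EuclideanSpace ℝ (Fin d) → ℝ → EuclideanSpace ℝ (Fin d))
    (y : ℝ → EuclideanSpace ℝ (Fin d)) : Prop where
  cont : ContinuousOn y (Ioc 0 S.T)
  flow : ∀ t ∈ Ioo 0 S.T, HasDerivAt y (-(S.γ t • (y t + f (y t) t))) t

/-- The trajectory `y` ends at `p`. -/
def EndsAt (y : ℝ → EuclideanSpace ℝ (Fin d)) (p : EuclideanSpace ℝ (Fin d)) : Prop :=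
  Tendsto y (𝓝[>] 0) (𝓝 p)

/-- The trajectory `y` has a bounded derivative, and it converges to a point that has only one
nearest point in `O`. -/
def IsRegular (S : NoiseSchedule) (O : Set (EuclideanSpace ℝ (Fin d)))
    (y : ℝ → EuclideanSpace ℝ (Fin d)) : Prop :=
  (∃ C : ℝ, ∀ t ∈ Ioo 0 S.T, ‖deriv y t‖ ≤ C) ∧ ∃ p, EndsAt y p ∧ ∃! z, IsNearest O p z

/-- The prediction space `Ω_f`: the endpoints of all denoising trajectories. -/
def predictionSpace (S : NoiseSchedule)
    (f : EuclideanSpace ℝ (Fin d) → ℝ → EuclideanSpace ℝ (Fin d)) :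
    Set (EuclideanSpace ℝ (Fin d)) :=
  {p | ∃ y, IsTrajectory S f y ∧ EndsAt y p}

/-- The endpoints of the regular denoising trajectories; all of `Ω_f` if all are regular. -/
def regularEndpoints (S : NoiseSchedule) (O : Set (EuclideanSpace ℝ (Fin d)))
    (f : EuclideanSpace ℝ (Fin d) → ℝ → EuclideanSpace ℝ (Fin d)) :
    Set (EuclideanSpace ℝ (Fin d)) :=
  {p | ∃ y, IsTrajectory S f y ∧ IsRegular S O y ∧ EndsAt y p}

/-- Every data point is a fixed point of the denoising flow of `f` at all times, that is, a zero of
the vector field `z ↦ z + f(z, t)`. -/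
def DataFixed (S : NoiseSchedule) (D : Finset (EuclideanSpace ℝ (Fin d)))
    (f : EuclideanSpace ℝ (Fin d) → ℝ → EuclideanSpace ℝ (Fin d)) : Prop :=
  ∀ z ∈ D, ∀ t ∈ Ioo 0 S.T, z + f z t = 0

end Diffusion

end

/-! The idea is to identify a trained model explicitly and then read off its flow near time `0`. Let
`ν` be the sum over `z ∈ D` of the uniform distributions on the orbits of `z`. Standard Gaussian
noise is rotation invariant, so the loss of an equivariant model is constant along orbits, and
averaging it over `D` is the same as averaging it over `ν`. For the prior `ν` the best of all models
is the score of the diffused distribution (`lintegral_noiseLoss_eq`), which is itself continuous and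
equivariant, hence an admissible competitor. The minimal loss is finite and the excess is a weighted
square distance with positive weight, so a trained model equals this score everywhere
(`IsTrained.eq_mixtureModel`).

By Tweedie's formula the velocity is then, up to sign, `γ / (1 - α)` times `√α m - α y`, where `m`
is the posterior mean of the clean point. If `y → p` and `z` is the only nearest point to `p`, then
`m → z` by Laplace's principle (`tendsto_posteriorMean`), so the second factor tends to `z - p`. The
first factor is half the logarithmic derivative of `1 - α`, up to sign and a factor tending to `1`;
it is unbounded because `1 - α → 0`. A bounded velocity therefore forces `p = z`
(`endpoint_eq_nearest`).

The reverse inclusions use no training: the group carries trajectories to trajectories, so reaching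
`D` implies reaching `G(D)`. -/

namespace Diffusion

/-! ### Density of the standard Gaussian. -/

section Gaussian

variable (E : Type*) [NormedAddCommGroup E] [InnerProductSpace ℝ E] [FiniteDimensional ℝ E]
  [MeasurableSpace E] [BorelSpace E]

/-- The standard Gaussian has a density proportional to `exp (-‖x‖² / 2)`. -/
theorem exists_stdGaussian_eq_withDensity :
    ∃ k : ℝ, 0 < k ∧ stdGaussian E =
      (volume : Measure E).withDensity fun x => ENNReal.ofReal (k * Real.exp (-‖x‖ ^ 2 / 2)) := by
  have hI : ∫ v : E, Real.exp (-(1 / 2 : ℝ) * ‖v‖ ^ 2)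
      = (Real.pi / (1 / 2)) ^ (Module.finrank ℝ E / 2 : ℝ) :=
    GaussianFourier.integral_rexp_neg_mul_sq_norm (by norm_num)
  have hIpos : 0 < ∫ v : E, Real.exp (-(1 / 2 : ℝ) * ‖v‖ ^ 2) := by
    rw [hI]; positivity
  -- The Bochner integral of a non-integrable function is `0` by convention, so a positive integral
  -- proves integrability.
  have hint : Integrable fun v : E => Real.exp (-(1 / 2 : ℝ) * ‖v‖ ^ 2) := by
    by_contra h
    rw [integral_undef h] at hIpos
    exact hIpos.ne rfl
  set I := ∫ v : E, Real.exp (-(1 / 2 : ℝ) * ‖v‖ ^ 2) with hIdef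
  have hIC : (I : ℂ) = (Real.pi / (1 / 2 : ℂ)) ^ (Module.finrank ℝ E / 2 : ℂ) := by
    rw [← GaussianFourier.integral_cexp_neg_mul_sq_norm (V := E) (b := 1 / 2) (by norm_num), hIdef,
      ← integral_complex_ofReal]
    congr 1
    ext v
    push_cast
    rfl
  have hexp : ∀ x : E, I⁻¹ * Real.exp (-‖x‖ ^ 2 / 2)
      = I⁻¹ * Real.exp (-(1 / 2 : ℝ) * ‖x‖ ^ 2) := fun x => by congr 2; ring
  refine ⟨I⁻¹, inv_pos.2 hIpos, ?_⟩
  simp only [hexp]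
  have hint' : Integrable fun v : E => I⁻¹ * Real.exp (-(1 / 2 : ℝ) * ‖v‖ ^ 2) :=
    hint.const_mul _
  have : IsFiniteMeasure ((volume : Measure E).withDensity fun x =>
      ENNReal.ofReal (I⁻¹ * Real.exp (-(1 / 2 : ℝ) * ‖x‖ ^ 2))) :=
    isFiniteMeasure_withDensity_ofReal hint'.2
  -- Finite measures are determined by their characteristic functions; the one of the density comes
  -- from the Gaussian Fourier integral, whose constant is `I` by `hIC`.
  apply Measure.ext_of_charFun
  ext t
  rw [charFun_stdGaussian, charFun_apply, integral_withDensity_eq_integral_toReal_smul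
    (by fun_prop) (by simp)]
  have := GaussianFourier.integral_cexp_neg_mul_sq_norm_add (V := E) (b := 1 / 2) (by norm_num)
    Complex.I t
  have h2 : ∀ x : E, (ENNReal.ofReal (I⁻¹ * Real.exp (-(1 / 2 : ℝ) * ‖x‖ ^ 2))).toReal •
      Complex.exp ((inner ℝ x t : ℝ) * Complex.I) =
      (I : ℂ)⁻¹ * Complex.exp (-(1 / 2) * ‖x‖ ^ 2 + Complex.I * (inner ℝ t x : ℝ)) := by
    intro x
    rw [ENNReal.toReal_ofReal (by positivity), Complex.real_smul, Complex.exp_add,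
      real_inner_comm]
    push_cast
    rw [mul_comm Complex.I]
    ring
  simp_rw [h2]
  rw [integral_const_mul, this, ← hIC, ← mul_assoc,
    inv_mul_cancel₀ (by exact_mod_cast hIpos.ne'), one_mul]
  congr 1
  rw [Complex.I_sq]
  ring

end Gaussian

/-! ### Posterior means, mixture scores and Laplace's principle. -/

section Posterior

variable {E : Type*} [NormedAddCommGroup E] [InnerProductSpace ℝ E]

/-- The unnormalized likelihood of the observation `y = a x + q⁻¹ η`, with `η` standard
Gaussian. -/
noncomputable def likelihood (a q : ℝ) (y x : E) : ℝ := Real.exp (-‖q • (y - a • x)‖ ^ 2 / 2)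

theorem likelihood_pos (a q : ℝ) (y x : E) : 0 < likelihood a q y x := Real.exp_pos _

theorem likelihood_map (A : E ≃ₗᵢ[ℝ] E) (a q : ℝ) (y x : E) :
    likelihood a q (A y) (A x) = likelihood a q y x := by
  unfold likelihood
  rw [← map_smul A a x, ← map_sub, ← map_smul, A.norm_map]

theorem continuous_likelihood :
    Continuous fun p : (ℝ × ℝ × E) × E => likelihood p.1.1 p.1.2.1 p.1.2.2 p.2 := by
  unfold likelihood
  fun_prop

theorem continuous_likelihood_right (a q : ℝ) (y : E) : Continuous (likelihood a q y) := by
  unfold likelihood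
  fun_prop

variable [MeasurableSpace E]

/-- The unnormalized marginal density of `y = a x + q⁻¹ η` for `x` with prior `ν`. -/
noncomputable def evidence (ν : Measure E) (a q : ℝ) (y : E) : ℝ := ∫ x, likelihood a q y x ∂ν

/-- The posterior mean of `x` given `y = a x + q⁻¹ η`. -/
noncomputable def posteriorMean (ν : Measure E) (a q : ℝ) (y : E) : E :=
  (evidence ν a q y)⁻¹ • ∫ x, likelihood a q y x • x ∂ν

/-- The score of the marginal distribution of `y = a x + q⁻¹ η` (Tweedie's formula). -/
noncomputable def mixtureScore (ν : Measure E) (a q : ℝ) (y : E) : E :=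
  q ^ 2 • (a • posteriorMean ν a q y - y)

variable [BorelSpace E] {ν : Measure E}

theorem evidence_map (A : E ≃ₗᵢ[ℝ] E) (hA : ν.map A = ν) (a q : ℝ) (y : E) :
    evidence ν a q (A y) = evidence ν a q y := by
  unfold evidence
  conv_lhs => rw [← hA]
  rw [(show MeasurableEmbedding A from A.toHomeomorph.measurableEmbedding).integral_map (g := likelihood a q (A y))]
  exact integral_congr_ae (.of_forall fun x => likelihood_map A a q y x)

theorem posteriorMean_map (A : E ≃ₗᵢ[ℝ] E) (hA : ν.map A = ν) (a q : ℝ) (y : E) :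
    posteriorMean ν a q (A y) = A (posteriorMean ν a q y) := by
  have h : ∫ x, likelihood a q (A y) x • x ∂ν = A (∫ x, likelihood a q y x • x ∂ν) := by
    conv_lhs => rw [← hA]
    rw [(show MeasurableEmbedding A from A.toHomeomorph.measurableEmbedding).integral_map (g := fun x => likelihood a q (A y) x • x),
      show A (∫ x, likelihood a q y x • x ∂ν) =
        A.toContinuousLinearEquiv (∫ x, likelihood a q y x • x ∂ν) from rfl,
      ← A.toContinuousLinearEquiv.integral_comp_comm]
    refine integral_congr_ae (.of_forall fun x => ?_)
    change likelihood a q (A y) (A x) • A x = A (likelihood a q y x • x)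
    rw [likelihood_map, map_smul]
  rw [posteriorMean, evidence_map A hA, h, posteriorMean, map_smul]

theorem mixtureScore_map (A : E ≃ₗᵢ[ℝ] E) (hA : ν.map A = ν) (a q : ℝ) (y : E) :
    mixtureScore ν a q (A y) = A (mixtureScore ν a q y) := by
  rw [mixtureScore, posteriorMean_map A hA, mixtureScore, map_smul, map_sub, map_smul]

variable [FiniteDimensional ℝ E] [IsFiniteMeasure ν] {K : Set E}

theorem integrable_of_continuous_of_ae_mem {F : Type*} [NormedAddCommGroup F] (hK : IsCompact K)
    (hν : ∀ᵐ x ∂ν, x ∈ K) {g : E → F} (hg : Continuous g) : Integrable g ν := by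
  rw [← Measure.restrict_eq_self_of_ae_mem hν]
  exact hg.continuousOn.integrableOn_compact hK

theorem continuous_evidence (hK : IsCompact K) (hν : ∀ᵐ x ∂ν, x ∈ K) :
    Continuous fun p : ℝ × ℝ × E => evidence ν p.1 p.2.1 p.2.2 := by
  have := continuous_parametric_integral_of_continuous (μ := ν)
    (f := fun (p : ℝ × ℝ × E) x => likelihood p.1 p.2.1 p.2.2 x) continuous_likelihood hK
  rwa [Measure.restrict_eq_self_of_ae_mem hν] at this

theorem evidence_pos [NeZero ν] (hK : IsCompact K) (hν : ∀ᵐ x ∂ν, x ∈ K) (a q : ℝ) (y : E) :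
    0 < evidence ν a q y :=
  integral_exp_pos (integrable_of_continuous_of_ae_mem hK hν (continuous_likelihood_right a q y))

theorem continuous_posteriorMean [NeZero ν] (hK : IsCompact K) (hν : ∀ᵐ x ∂ν, x ∈ K) :
    Continuous fun p : ℝ × ℝ × E => posteriorMean ν p.1 p.2.1 p.2.2 := by
  have := continuous_parametric_integral_of_continuous (μ := ν)
    (f := fun (p : ℝ × ℝ × E) x => likelihood p.1 p.2.1 p.2.2 x • x)
    (continuous_likelihood.smul continuous_snd) hK
  rw [Measure.restrict_eq_self_of_ae_mem hν] at this
  exact ((continuous_evidence hK hν).inv₀ fun p => (evidence_pos hK hν _ _ _).ne').smul this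

theorem continuous_mixtureScore [NeZero ν] (hK : IsCompact K) (hν : ∀ᵐ x ∂ν, x ∈ K) :
    Continuous fun p : ℝ × ℝ × E => mixtureScore ν p.1 p.2.1 p.2.2 := by
  have := continuous_posteriorMean hK hν
  unfold mixtureScore
  fun_prop

/-- A quantitative Laplace estimate: if the points of `N` are at distance at most `r` from `y` and
those of `K` far from `z` are at distance at least `r + δ`, then the posterior concentrates
at `z`. -/
theorem norm_posteriorMean_sub_le (hK : IsCompact K) (hν : ∀ᵐ x ∂ν, x ∈ K) {N : Set E}
    (hN : MeasurableSet N) (hNpos : ν N ≠ 0) {z y : E} {a q r δ ε R : ℝ} (hr : 0 ≤ r)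
    (hδ : 0 ≤ δ) (hε : 0 ≤ ε)
    (hR : ∀ x ∈ K, ‖x - z‖ ≤ R) (hnear : ∀ x ∈ K, x ∈ N → ‖y - a • x‖ ≤ r)
    (hfar : ∀ x ∈ K, ε ≤ ‖x - z‖ → r + δ ≤ ‖y - a • x‖) :
    ‖posteriorMean ν a q y - z‖ ≤
      ε + R * ν.real univ / ν.real N * Real.exp (-(q ^ 2 * δ ^ 2 / 2)) := by
  have hNr : 0 < ν.real N := ENNReal.toReal_pos hNpos (measure_ne_top _ _)
  have : NeZero ν := ⟨fun h => hNpos (by simp [h])⟩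
  have hcl := continuous_likelihood_right a q y
  have hil := integrable_of_continuous_of_ae_mem hK hν hcl
  have hev := evidence_pos hK hν a q y
  have hR0 : 0 ≤ R := by
    obtain ⟨x, hx⟩ := hν.exists
    exact (norm_nonneg _).trans (hR x hx)
  -- `A` is the least likelihood on `N`, which bounds the evidence below. Since `r² + δ² ≤ (r +
  -- δ)²`, far points have likelihood at most `A * B`, and `A` cancels in the quotient.
  set A := Real.exp (-(q ^ 2 * r ^ 2 / 2)) with hA
  set B := Real.exp (-(q ^ 2 * δ ^ 2 / 2)) with hB
  have hlik : ∀ x, likelihood a q y x = Real.exp (-(q ^ 2 * ‖y - a • x‖ ^ 2 / 2)) := fun x => by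
    rw [likelihood, norm_smul, mul_pow, Real.norm_eq_abs, sq_abs]; congr 1; ring
  have hlow : A * ν.real N ≤ evidence ν a q y := by
    calc A * ν.real N = ∫ x in N, A ∂ν := by simp [mul_comm]
      _ ≤ ∫ x in N, likelihood a q y x ∂ν := by
        refine integral_mono_ae (integrable_const _) hil.integrableOn ?_
        filter_upwards [ae_restrict_of_ae hν, ae_restrict_mem hN] with x hxK hxN
        rw [hlik]
        have := hnear x hxK hxN
        exact Real.exp_le_exp.2 (by gcongr)
      _ ≤ _ := setIntegral_le_integral hil (.of_forall fun x => (likelihood_pos a q y x).le)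
  have hnum : posteriorMean ν a q y - z
      = (evidence ν a q y)⁻¹ • ∫ x, likelihood a q y x • (x - z) ∂ν := by
    have hix : Integrable (fun x => likelihood a q y x • x) ν :=
      integrable_of_continuous_of_ae_mem hK hν (hcl.smul continuous_id)
    have h1 : ∫ x, likelihood a q y x • (x - z) ∂ν
        = (∫ x, likelihood a q y x • x ∂ν) - evidence ν a q y • z := by
      simp_rw [smul_sub]
      rw [integral_sub hix (hil.smul_const z), integral_smul_const, evidence]
    rw [h1, smul_sub, inv_smul_smul₀ hev.ne', posteriorMean]
  have hup : ‖∫ x, likelihood a q y x • (x - z) ∂ν‖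
      ≤ ε * evidence ν a q y + R * (A * B) * ν.real univ := by
    calc _ ≤ ∫ x, (ε * likelihood a q y x + R * (A * B)) ∂ν := by
          refine norm_integral_le_of_norm_le ((hil.const_mul ε).add (integrable_const _)) ?_
          filter_upwards [hν] with x hx
          rw [norm_smul, Real.norm_of_nonneg (likelihood_pos a q y x).le]
          have hl0 := (likelihood_pos a q y x).le
          have hAB : 0 ≤ R * (A * B) := by positivity
          rcases le_total ε ‖x - z‖ with h | h
          · have h2 := hfar x hx h
            have h3 : likelihood a q y x ≤ A * B := by
              rw [hlik, hA, hB, ← Real.exp_add]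
              apply Real.exp_le_exp.2
              have : r ^ 2 + δ ^ 2 ≤ ‖y - a • x‖ ^ 2 := by nlinarith
              nlinarith [sq_nonneg q]
            nlinarith [hR x hx, mul_le_mul h3 (hR x hx) (norm_nonneg _) (by positivity)]
          · nlinarith
      _ = _ := by
        rw [integral_add (hil.const_mul ε) (integrable_const _), integral_const_mul, evidence]
        simp [mul_comm]
  rw [hnum, norm_smul, norm_inv, Real.norm_of_nonneg hev.le, inv_mul_le_iff₀ hev]
  refine hup.trans ?_
  have h5 : R * (A * B) * ν.real univ
      = (R * ν.real univ / ν.real N * B) * (A * ν.real N) := by field_simp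
  have h6 : 0 ≤ R * ν.real univ / ν.real N * B := by positivity
  rw [h5]
  nlinarith [mul_le_mul_of_nonneg_left hlow h6]

/-- As the noise vanishes, the posterior mean tends to the point of the support that is nearest
to the limit of the observations. -/
theorem tendsto_posteriorMean {ι : Type*} {l : Filter ι} (hK : IsCompact K)
    (hν : ∀ᵐ x ∂ν, x ∈ K) {p z : E} (hz : ∀ U : Set E, IsOpen U → z ∈ U → ν U ≠ 0)
    (hnear : ∀ x ∈ K, dist p x ≤ dist p z → x = z) {a q : ι → ℝ} {y : ι → E}
    (ha : Tendsto a l (𝓝 1)) (hq : Tendsto q l atTop) (hy : Tendsto y l (𝓝 p)) :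
    Tendsto (fun i => posteriorMean ν (a i) (q i) (y i)) l (𝓝 z) := by
  rw [tendsto_iff_norm_sub_tendsto_zero, Metric.tendsto_nhds]
  intro ε hε
  obtain ⟨B, hB⟩ := hK.isBounded.exists_norm_le
  obtain ⟨R, hR⟩ := (hK.image (continuous_sub_right z)).isBounded.exists_norm_le
  have hR' : ∀ x ∈ K, ‖x - z‖ ≤ R := fun x hx => hR _ (mem_image_of_mem _ hx)
  -- Budget for the gap `4 * δ`: replacing `p - x` by `y - a x` costs at most `δ`. Points of `N`
  -- then lie within `dist p z + 2 * δ`, the value of `r` below, and far points beyond `dist p z + 3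
  -- * δ = r + δ`.
  obtain ⟨δ, hδ, hsep⟩ : ∃ δ > 0, ∀ x ∈ K, ε / 2 ≤ ‖x - z‖ → dist p z + 4 * δ ≤ dist p x := by
    have hF : IsCompact (K ∩ {x | ε / 2 ≤ ‖x - z‖}) :=
      hK.inter_right (isClosed_le continuous_const (by fun_prop))
    rcases (K ∩ {x | ε / 2 ≤ ‖x - z‖}).eq_empty_or_nonempty with h | h
    · refine ⟨1, one_pos, fun x hx hx' => ?_⟩
      exact absurd (show x ∈ K ∩ {x | ε / 2 ≤ ‖x - z‖} from ⟨hx, hx'⟩) (by simp [h])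
    · obtain ⟨x₀, hx₀, hmin⟩ := hF.exists_isMinOn h (f := fun x => dist p x) (by fun_prop)
      have hlt : dist p z < dist p x₀ := by
        by_contra hle
        have := hnear x₀ hx₀.1 (not_lt.1 hle)
        have h2 := hx₀.2
        simp only [this, mem_ofPred_eq, sub_self, norm_zero] at h2
        linarith
      refine ⟨(dist p x₀ - dist p z) / 4, by linarith, fun x hx hx' => ?_⟩
      have : dist p x₀ ≤ dist p x := hmin ⟨hx, hx'⟩
      linarith
  set N := {x : E | dist p x < dist p z + δ} with hNdef
  have hNo : IsOpen N := isOpen_lt (by fun_prop) continuous_const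
  have hNz : ν N ≠ 0 := hz N hNo (by simp [hNdef, hδ])
  have herr : Tendsto (fun i => ‖y i - p‖ + |1 - a i| * B) l (𝓝 0) := by
    have h1 : Tendsto (fun i => ‖y i - p‖) l (𝓝 0) := tendsto_iff_norm_sub_tendsto_zero.1 hy
    have h2 : Tendsto (fun i => |1 - a i|) l (𝓝 0) := by
      simpa using (ha.const_sub 1).abs
    simpa using h1.add (h2.mul_const B)
  have hexp : Tendsto (fun i => R * ν.real univ / ν.real N * Real.exp (-(q i ^ 2 * δ ^ 2 / 2))) l
      (𝓝 0) := by
    have h1 : Tendsto (fun i => q i ^ 2 * (δ ^ 2 / 2)) l atTop :=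
      ((tendsto_pow_atTop two_ne_zero).comp hq).atTop_mul_const (by positivity)
    simpa [mul_div_assoc] using
      (Real.tendsto_exp_neg_atTop_nhds_zero.comp h1).const_mul (R * ν.real univ / ν.real N)
  filter_upwards [herr.eventually_lt_const hδ, hexp.eventually_lt_const (half_pos hε)]
    with i hi hi'
  have hdist : ∀ x ∈ K, |‖y i - a i • x‖ - dist p x| ≤ δ := fun x hx => by
    rw [dist_eq_norm]
    refine (abs_norm_sub_norm_le _ _).trans ?_
    have h1 : y i - a i • x - (p - x) = (y i - p) + (1 - a i) • x := by
      rw [sub_smul, one_smul]; abel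
    rw [h1]
    refine (norm_add_le _ _).trans (le_trans ?_ hi.le)
    rw [norm_smul, Real.norm_eq_abs]
    gcongr
    exact hB x hx
  have := norm_posteriorMean_sub_le (a := a i) (q := q i) (y := y i) hK hν hNo.measurableSet hNz
    (r := dist p z + 2 * δ) (δ := δ) (by positivity) hδ.le (half_pos hε).le hR'
    (fun x hx hxN => by
      have h1 := abs_le.1 (hdist x hx)
      have h2 : dist p x < dist p z + δ := hxN
      linarith)
    (fun x hx hxF => by
      have h1 := abs_le.1 (hdist x hx)
      have h2 := hsep x hx hxF
      linarith)
  rw [dist_zero_right, norm_norm]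
  linarith

end Posterior

/-! ### The excess loss over the mixture score. -/

section Loss

variable {E : Type*} [NormedAddCommGroup E] [InnerProductSpace ℝ E] [FiniteDimensional ℝ E]

/-- The parallel axis theorem: the weighted mean square distance of `u` from `r` exceeds its
minimum, attained at the weighted mean `m`, by `‖u - m‖²` times the total weight. -/
theorem integral_mul_norm_sub_sq {X : Type*} [MeasurableSpace X] {ν : Measure X} {w : X → ℝ}
    {r : X → E} {m : E} (hw : Integrable w ν) (hwr : Integrable (fun x => w x • r x) ν)
    (hwm : Integrable (fun x => w x * ‖m - r x‖ ^ 2) ν)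
    (hm : ∫ x, w x • r x ∂ν = (∫ x, w x ∂ν) • m) (u : E) :
    Integrable (fun x => w x * ‖u - r x‖ ^ 2) ν ∧
    ∫ x, w x * ‖u - r x‖ ^ 2 ∂ν =
      ∫ x, w x * ‖m - r x‖ ^ 2 ∂ν + ‖u - m‖ ^ 2 * ∫ x, w x ∂ν := by
  have hd : Integrable (fun x => w x • (m - r x)) ν := by
    simp_rw [smul_sub]
    exact (hw.smul_const m).sub hwr
  have h0 : ∫ x, w x • (m - r x) ∂ν = 0 := by
    simp_rw [smul_sub]
    rw [integral_sub (hw.smul_const m) hwr, hm, integral_smul_const, sub_self]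
  have hexp : (fun x => w x * ‖u - r x‖ ^ 2) = fun x => w x * ‖m - r x‖ ^ 2
      + (‖u - m‖ ^ 2 * w x + 2 * inner ℝ (u - m) (w x • (m - r x))) := by
    ext x
    rw [← sub_add_sub_cancel u m (r x), norm_add_sq_real, real_inner_smul_right]
    ring
  have hi2 : Integrable (fun x => 2 * inner ℝ (u - m) (w x • (m - r x))) ν :=
    (hd.const_inner (u - m)).const_mul 2
  have hi3 : Integrable (fun x => ‖u - m‖ ^ 2 * w x + 2 * inner ℝ (u - m) (w x • (m - r x))) ν :=
    (hw.const_mul _).add hi2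
  rw [hexp]
  refine ⟨hwm.add hi3, ?_⟩
  rw [integral_add hwm hi3, integral_add (hw.const_mul _) hi2,
    integral_const_mul, integral_const_mul, integral_inner hd, h0, inner_zero_right, mul_zero,
    add_zero]

variable [MeasurableSpace E]

/-- The loss of the score model `f` at the data point `x` and the noise level
`y = a x + b η`. -/
noncomputable def noiseLoss (a b : ℝ) (f : E → E) (x : E) : ℝ≥0∞ :=
  ∫⁻ η, ‖-(b • f (a • x + b • η)) - η‖ₑ ^ 2 ∂(stdGaussian E)

/-- The zero model has loss `𝔼 ‖η‖²`, whatever the data and the noise level. -/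
theorem noiseLoss_zero_eq (a b a' b' : ℝ) (x x' : E) :
    noiseLoss a b (fun _ : E => (0 : E)) x = noiseLoss a' b' (fun _ : E => (0 : E)) x' := by
  simp [noiseLoss]

variable [BorelSpace E]

theorem lintegral_comp_const_add_smul (g : E → ℝ≥0∞) (hg : Measurable g) (c : E) {b : ℝ}
    (hb : 0 < b) :
    ∫⁻ η, g (c + b • η) = ENNReal.ofReal (b ^ Module.finrank ℝ E)⁻¹ * ∫⁻ y, g y := by
  have h1 : ∫⁻ η, g (c + b • η) = ∫⁻ y, g (c + y) ∂((volume : Measure E).map (b • ·)) := by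
    rw [lintegral_map (by fun_prop) (by fun_prop)]
  rw [h1, Measure.map_addHaar_smul _ hb.ne', lintegral_smul_measure, smul_eq_mul,
    lintegral_add_left_eq_self g c, abs_of_pos (by positivity)]

/-- Passing from the noise `η` to the observation `y` makes the domain of integration independent of
`x`, so that the integral over the prior can be taken first. -/
theorem lintegral_stdGaussian_comp_const_add_smul {k : ℝ} (hk : 0 < k)
    (h : stdGaussian E =
      (volume : Measure E).withDensity fun x => ENNReal.ofReal (k * Real.exp (-‖x‖ ^ 2 / 2)))
    {g : E → ℝ≥0∞} (hg : Measurable g) (a : ℝ) (x : E) {b : ℝ} (hb : 0 < b) :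
    ∫⁻ η, g (a • x + b • η) ∂(stdGaussian E) =
      ∫⁻ y, ENNReal.ofReal (k * (b ^ Module.finrank ℝ E)⁻¹) *
        (ENNReal.ofReal (likelihood a b⁻¹ y x) * g y) := by
  have hl : Measurable fun y => likelihood a b⁻¹ y x := by
    unfold likelihood
    fun_prop
  rw [h, lintegral_withDensity_eq_lintegral_mul _ (by fun_prop) (by fun_prop)]
  have := lintegral_comp_const_add_smul
    (fun y => ENNReal.ofReal k * (ENNReal.ofReal (likelihood a b⁻¹ y x) * g y))
    (by fun_prop) (a • x) hb
  rw [lintegral_const_mul _ (by fun_prop), mul_comm k, ENNReal.ofReal_mul (by positivity),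
    mul_assoc, ← lintegral_const_mul _ (by fun_prop), ← this]
  refine lintegral_congr fun η => ?_
  simp only [Pi.mul_apply, likelihood, add_sub_cancel_left, inv_smul_smul₀ hb.ne']
  rw [ENNReal.ofReal_mul hk.le, mul_assoc]

theorem measurable_noiseLoss (a b : ℝ) {f : E → E} (hf : Continuous f) :
    Measurable (noiseLoss a b f) := by
  have : Measurable fun p : E × E => ‖-(b • f (a • p.1 + b • p.2)) - p.2‖ₑ ^ 2 := by fun_prop
  exact this.lintegral_prod_right'

theorem noiseLoss_zero_lt_top (a b : ℝ) (x : E) : noiseLoss a b (fun _ : E => (0 : E)) x < ∞ := by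
  have h : MemLp (id : E → E) 2 (stdGaussian E) := IsGaussian.memLp_two_id
  have := h.eLpNorm_lt_top
  rw [eLpNorm_lt_top_iff_lintegral_rpow_enorm_lt_top (by norm_num) (by norm_num)] at this
  simpa [noiseLoss] using this

/-- The Gaussian is rotation invariant, so the noise may be rotated together with the data point. -/
theorem noiseLoss_map (A : E ≃ₗᵢ[ℝ] E) (a b : ℝ) {f : E → E} (hf : ∀ y, f (A y) = A (f y))
    (x : E) : noiseLoss a b f (A x) = noiseLoss a b f x := by
  unfold noiseLoss
  conv_lhs => rw [← stdGaussian_map A]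
  rw [(show MeasurableEmbedding A from A.toHomeomorph.measurableEmbedding).lintegral_map]
  refine lintegral_congr fun η => ?_
  rw [← map_smul, ← map_smul, ← map_add, hf, ← map_smul, ← map_neg, ← map_sub,
    LinearIsometryEquiv.enorm_map]

variable {ν : Measure E} [IsFiniteMeasure ν] [NeZero ν] {K : Set E}

/-- The excess loss of a model over the mixture score. -/
theorem lintegral_noiseLoss_eq (hK : IsCompact K) (hν : ∀ᵐ x ∂ν, x ∈ K) {k : ℝ} (hk : 0 < k)
    (h : stdGaussian E =
      (volume : Measure E).withDensity fun x => ENNReal.ofReal (k * Real.exp (-‖x‖ ^ 2 / 2)))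
    (a : ℝ) {b : ℝ} (hb : 0 < b) {f : E → E} (hf : Continuous f) :
    ∫⁻ x, noiseLoss a b f x ∂ν = ∫⁻ x, noiseLoss a b (mixtureScore ν a b⁻¹) x ∂ν +
      ∫⁻ y, ENNReal.ofReal (k * (b ^ Module.finrank ℝ E)⁻¹ *
        (b ^ 2 * ‖f y - mixtureScore ν a b⁻¹ y‖ ^ 2 * evidence ν a b⁻¹ y)) := by
  set c := k * (b ^ Module.finrank ℝ E)⁻¹ with hc
  have hc0 : 0 < c := by positivity
  -- `r y x` is the score at `y` of the Gaussian centred at `a x` with variance `b²`. Its posterior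
  -- average over `x` is the mixture score, and it equals `-b⁻¹ η` at `y = a x + b η`; the loss is
  -- thus a weighted square distance to `r`, to which the parallel axis theorem applies at each `y`.
  set r : E → E → E := fun y x => (b⁻¹) ^ 2 • (a • x - y) with hr
  have hscore : Continuous (mixtureScore ν a b⁻¹) :=
    (continuous_mixtureScore hK hν).comp (by fun_prop : Continuous fun y : E => (a, b⁻¹, y))
  have hlik : Measurable fun p : E × E => likelihood a b⁻¹ p.2 p.1 := by
    unfold likelihood
    fun_prop
  have hint : ∀ (u : E) (y : E),
      Integrable (fun x => likelihood a b⁻¹ y x * ‖u - r y x‖ ^ 2) ν := fun u y =>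
    integrable_of_continuous_of_ae_mem hK hν
      ((continuous_likelihood_right a b⁻¹ y).mul (by fun_prop))
  have key : ∀ {g : E → E}, Continuous g → ∫⁻ x, noiseLoss a b g x ∂ν =
      ∫⁻ y, ENNReal.ofReal (c * (b ^ 2 * ∫ x, likelihood a b⁻¹ y x * ‖g y - r y x‖ ^ 2 ∂ν)) := by
    intro g hg
    have h1 : ∀ x, noiseLoss a b g x = ∫⁻ y, ENNReal.ofReal (c * (b ^ 2 *
        (likelihood a b⁻¹ y x * ‖g y - r y x‖ ^ 2))) := by
      intro x
      have h2 : noiseLoss a b g x = ∫⁻ η, (fun y => ENNReal.ofReal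
          (b ^ 2 * ‖g y - r y x‖ ^ 2)) (a • x + b • η) ∂(stdGaussian E) := by
        refine lintegral_congr fun η => ?_
        have h3 : -(b • g (a • x + b • η)) - η
            = -(b • (g (a • x + b • η) - r (a • x + b • η) x)) := by
          simp only [hr]
          rw [sub_add_cancel_left, smul_neg, sub_neg_eq_add, smul_add, smul_smul, smul_smul]
          rw [show b * b⁻¹ ^ 2 * b = 1 by field_simp, one_smul]
          abel
        rw [h3, enorm_neg, ← ofReal_norm, ← ENNReal.ofReal_pow (norm_nonneg _), norm_smul,
          mul_pow, Real.norm_eq_abs, sq_abs]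
      rw [h2, lintegral_stdGaussian_comp_const_add_smul hk h
        (g := fun y => ENNReal.ofReal (b ^ 2 * ‖g y - r y x‖ ^ 2)) (by fun_prop) a x hb]
      refine lintegral_congr fun y => ?_
      rw [← ENNReal.ofReal_mul (likelihood_pos _ _ _ _).le, ← ENNReal.ofReal_mul hc0.le]
      congr 1
      ring
    simp_rw [h1]
    rw [lintegral_lintegral_swap (Measurable.aemeasurable (by
      simp only [Function.uncurry_def]
      fun_prop))]
    refine lintegral_congr fun y => ?_
    rw [← integral_const_mul, ← integral_const_mul, ofReal_integral_eq_lintegral_ofReal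
      (((hint _ y).const_mul _).const_mul _)]
    exact .of_forall fun x => by
      have := (likelihood_pos a b⁻¹ y x).le
      change 0 ≤ _
      positivity
  rw [key hf, key hscore, ← lintegral_add_right _ (by
    have h4 : Continuous (evidence ν a b⁻¹) :=
      (continuous_evidence hK hν).comp (by fun_prop : Continuous fun y : E => (a, b⁻¹, y))
    fun_prop)]
  refine lintegral_congr fun y => ?_
  have hev := evidence_pos hK hν a b⁻¹ y
  have hwi := integrable_of_continuous_of_ae_mem hK hν (continuous_likelihood_right a b⁻¹ y)
  have hwx : Integrable (fun x => likelihood a b⁻¹ y x • x) ν :=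
    integrable_of_continuous_of_ae_mem hK hν ((continuous_likelihood_right a b⁻¹ y).smul
      continuous_id')
  have hpar := (integral_mul_norm_sub_sq (w := likelihood a b⁻¹ y) (r := r y) hwi
    (integrable_of_continuous_of_ae_mem hK hν ((continuous_likelihood_right a b⁻¹ y).smul
      (by fun_prop))) (hint _ y) (m := mixtureScore ν a b⁻¹ y) (by
      have h5 : ∀ x, likelihood a b⁻¹ y x • r y x = (b⁻¹ ^ 2 * a) • (likelihood a b⁻¹ y x • x)
          - likelihood a b⁻¹ y x • (b⁻¹ ^ 2 • y) := fun x => by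
        simp only [hr]
        module
      have h6 : Integrable (fun x => (b⁻¹ ^ 2 * a) • (likelihood a b⁻¹ y x • x)) ν := hwx.smul _
      simp_rw [h5]
      have hm : ∫ x, likelihood a b⁻¹ y x • x ∂ν
          = evidence ν a b⁻¹ y • posteriorMean ν a b⁻¹ y := by
        rw [posteriorMean, smul_inv_smul₀ hev.ne']
      rw [integral_sub h6 (hwi.smul_const _), integral_smul, integral_smul_const, hm]
      change _ = evidence ν a b⁻¹ y • _
      rw [show ∫ x, likelihood a b⁻¹ y x ∂ν = evidence ν a b⁻¹ y from rfl, mixtureScore]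
      module) (f y)).2
  rw [hpar, ← ENNReal.ofReal_add]
  · congr 1
    rw [show ∫ x, likelihood a b⁻¹ y x ∂ν = evidence ν a b⁻¹ y from rfl]
    ring
  · have : 0 ≤ ∫ x, likelihood a b⁻¹ y x * ‖mixtureScore ν a b⁻¹ y - r y x‖ ^ 2 ∂ν :=
      integral_nonneg fun x => by
        have := (likelihood_pos a b⁻¹ y x).le
        change 0 ≤ _
        positivity
    positivity
  · positivity

end Loss

/-! ### The orbit prior, from Haar measure on the closure of the group. -/

section InvariantMeasure

variable {E : Type*} [NormedAddCommGroup E] [InnerProductSpace ℝ E] [FiniteDimensional ℝ E]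

instance compactSpace_unitary : CompactSpace (unitary (E →L[ℝ] E)) := by
  have : ProperSpace (E →L[ℝ] E) := FiniteDimensional.proper ℝ _
  refine (isCompact_iff_compactSpace (s := (unitary (E →L[ℝ] E) : Set (E →L[ℝ] E)))).1 ?_
  refine Metric.isCompact_of_isClosed_isBounded isClosed_unitary
    (isBounded_iff_forall_norm_le.2 ⟨1, fun u hu => ?_⟩)
  refine ContinuousLinearMap.opNorm_le_bound _ zero_le_one fun x => ?_
  rw [one_mul]
  exact ((Unitary.linearIsometryEquiv ⟨u, hu⟩).norm_map x).le

variable {G : Type*} [Group G] (ρ : G →* (E ≃ₗᵢ[ℝ] E))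

/-- The closure of the image of a group of linear isometries, as a compact group of operators. -/
noncomputable def isometryClosure : Subgroup (unitary (E →L[ℝ] E)) :=
  (Unitary.linearIsometryEquiv.symm.toMonoidHom.comp ρ).range.topologicalClosure

theorem mem_isometryClosure (g : G) : Unitary.linearIsometryEquiv.symm (ρ g) ∈ isometryClosure ρ :=
  Subgroup.le_topologicalClosure _ ⟨g, rfl⟩

/-- A closed condition that holds on the image of `ρ` passes to its closure. -/
theorem isometryClosure_induction {ρ : G →* (E ≃ₗᵢ[ℝ] E)} {P : (E ≃ₗᵢ[ℝ] E) → Prop}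
    (hP : IsClosed {u : unitary (E →L[ℝ] E) | P (Unitary.linearIsometryEquiv u)})
    (hρ : ∀ g, P (ρ g)) {u : unitary (E →L[ℝ] E)} (hu : u ∈ isometryClosure ρ) :
    P (Unitary.linearIsometryEquiv u) := by
  refine closure_minimal ?_ hP hu
  rintro _ ⟨g, rfl⟩
  simpa using hρ g

theorem continuous_unitary_apply (x : E) :
    Continuous fun u : unitary (E →L[ℝ] E) => Unitary.linearIsometryEquiv u x :=
  (ContinuousLinearMap.apply ℝ E x).continuous.comp continuous_subtype_val

/-- A continuous equivariant map is equivariant under the closure of the group. -/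
theorem map_isometryClosure {f : E → E} (hf : Continuous f) (hρ : ∀ g y, f (ρ g y) = ρ g (f y))
    {u : unitary (E →L[ℝ] E)} (hu : u ∈ isometryClosure ρ) (y : E) :
    f (Unitary.linearIsometryEquiv u y) = Unitary.linearIsometryEquiv u (f y) :=
  isometryClosure_induction (P := fun A => f (A y) = A (f y))
    (isClosed_eq (hf.comp (continuous_unitary_apply y)) (continuous_unitary_apply _))
    (fun g => hρ g y) hu

instance compactSpace_isometryClosure : CompactSpace (isometryClosure ρ) :=
  isCompact_iff_compactSpace.1 (Subgroup.isClosed_topologicalClosure _).isCompact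

variable [MeasurableSpace E] [BorelSpace E]

/-- The properties of the mixture over `z ∈ D` of the uniform distributions on the (compact)
orbits of `z` under a group of linear isometries. -/
structure IsOrbitPrior (D : Finset E) (ν : Measure E) : Prop where
  finite : IsFiniteMeasure ν
  ae_mem : ∀ᵐ x ∂ν, x ∈ {p | ∃ g : G, ∃ z ∈ D, p = ρ g z}
  map_eq : ∀ g, ν.map (ρ g) = ν
  measure_ne_zero : ∀ g, ∀ z ∈ D, ∀ U : Set E, IsOpen U → ρ g z ∈ U → ν U ≠ 0
  lintegral_eq : ∀ F : E → ℝ≥0∞, Measurable F →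
    (∀ u ∈ isometryClosure ρ, ∀ x, F (Unitary.linearIsometryEquiv u x) = F x) →
    ∫⁻ x, F x ∂ν = ∑ z ∈ D, F z

/-- `G` carries no topology, but the closure of its image in the compact orthogonal group has a Haar
probability measure, which the orbit maps push forward to `E`. The closure may move `z` out of its
`G`-orbit, but not out of `G(D)`, which is closed. -/
theorem exists_isOrbitPrior (D : Finset E)
    (hO : IsClosed {p | ∃ g : G, ∃ z ∈ D, p = ρ g z}) :
    ∃ ν : Measure E, IsOrbitPrior ρ D ν := by
  let _ : MeasurableSpace (isometryClosure ρ) := borel _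
  have _ : BorelSpace (isometryClosure ρ) := ⟨rfl⟩
  set μ : Measure (isometryClosure ρ) := Measure.haarMeasure ⊤ with hμ
  have hμ1 : IsProbabilityMeasure μ := ⟨by
    exact Measure.haarMeasure_self (K₀ := (⊤ : TopologicalSpace.PositiveCompacts _))⟩
  set e : E → isometryClosure ρ → E := fun z u => Unitary.linearIsometryEquiv u.1 z with he
  have hec : ∀ z, Continuous (e z) := fun z =>
    (continuous_unitary_apply z).comp continuous_subtype_val
  have hle : ∀ z ∈ D, μ.map (e z) ≤ ∑ z ∈ D, μ.map (e z) := fun z hz =>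
    Finset.single_le_sum (f := fun z => μ.map (e z)) (fun _ _ => Measure.zero_le _) hz
  refine ⟨∑ z ∈ D, μ.map (e z), inferInstance, ?_, fun g => ?_, fun g z hz U hU hgz => ?_,
    fun F hF hinv => ?_⟩
  · rw [ae_iff, Measure.finsetSum_apply]
    refine Finset.sum_eq_zero fun z hz => ?_
    refine ae_iff.1 ((ae_map_iff (hec z).aemeasurable hO.measurableSet).2 ?_)
    refine .of_forall fun u => ?_
    exact isometryClosure_induction (P := fun A => A z ∈ {p | ∃ g : G, ∃ z ∈ D, p = ρ g z})
      (hO.preimage (continuous_unitary_apply z)) (fun g => ⟨g, z, hz, rfl⟩) u.2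
  · rw [← Measure.mapₗ_apply_of_measurable (ρ g).continuous.measurable, map_sum]
    refine Finset.sum_congr rfl fun z hz => ?_
    rw [Measure.mapₗ_apply_of_measurable (ρ g).continuous.measurable,
      Measure.map_map (ρ g).continuous.measurable (hec z).measurable]
    set v : isometryClosure ρ := ⟨_, mem_isometryClosure ρ g⟩ with hv
    -- The orbit map turns the action of `ρ g` into left translation, under which Haar measure is
    -- invariant.
    have h1 : ρ g ∘ e z = e z ∘ (v * ·) := by
      ext1 u
      simp only [he, hv, Function.comp_apply, Subgroup.coe_mul, map_mul]
      simp
    rw [h1, ← Measure.map_map (hec z).measurable (measurable_const_mul v), map_mul_left_eq_self]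
  · refine fun h0 => ?_
    have h1 : μ.map (e z) U = 0 := le_antisymm ((hle z hz U).trans h0.le) zero_le
    rw [Measure.map_apply (hec z).measurable hU.measurableSet] at h1
    refine (hU.preimage (hec z)).measure_ne_zero μ ⟨⟨_, mem_isometryClosure ρ g⟩, ?_⟩ h1
    simpa [he] using hgz
  · rw [lintegral_finsetSum_measure]
    refine Finset.sum_congr rfl fun z _ => ?_
    rw [lintegral_map hF (hec z).measurable]
    have : ∀ u, F (e z u) = F z := fun u => hinv u.1 u.2 z
    simp [this]

end InvariantMeasure

/-! ### Trained models are mixture scores. -/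

section Training

variable {d : ℕ} {G : Type*} [Group G] {S : NoiseSchedule}
  {ρ : G →* (EuclideanSpace ℝ (Fin d) ≃ₗᵢ[ℝ] EuclideanSpace ℝ (Fin d))}
  {D : Finset (EuclideanSpace ℝ (Fin d))}
  {f : EuclideanSpace ℝ (Fin d) → ℝ → EuclideanSpace ℝ (Fin d)}

theorem NoiseSchedule.sqrt_pos (S : NoiseSchedule) {t : ℝ} (ht : t ∈ Ioo 0 S.T) :
    0 < √(1 - S.α t) :=
  Real.sqrt_pos.2 (by linarith [(S.α_mem t ht).2])

theorem NoiseSchedule.continuousOn_Ioo (S : NoiseSchedule) : ContinuousOn S.α (Ioo 0 S.T) :=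
  S.α_cont.mono Ioo_subset_Icc_self

theorem IsEquivariantModel.continuous (hf : IsEquivariantModel S ρ f) {t : ℝ}
    (ht : t ∈ Ioo 0 S.T) : Continuous fun y => f y t :=
  hf.cont.comp_continuous (by fun_prop : Continuous fun y => (y, t)) fun _ => ⟨mem_univ _, ht⟩

/-- The nearest point to a point of the closure is at distance zero from it. -/
theorem isClosed_orbitSet (hmin : ∀ y, ∃ z, IsNearest (orbitSet ρ D) y z) :
    IsClosed (orbitSet ρ D) := by
  refine isClosed_of_closure_subset fun y hy => ?_
  obtain ⟨z, hz, hle⟩ := hmin y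
  rw [Metric.mem_closure_iff] at hy
  have : dist y z = 0 := by
    by_contra hne
    obtain ⟨w, hw, hlt⟩ := hy (dist y z) (lt_of_le_of_ne dist_nonneg (Ne.symm hne))
    exact absurd (hle w hw) (not_le.2 hlt)
  rwa [dist_eq_zero.1 this]

theorem isCompact_orbitSet (hmin : ∀ y, ∃ z, IsNearest (orbitSet ρ D) y z) :
    IsCompact (orbitSet ρ D) := by
  refine Metric.isCompact_of_isClosed_isBounded (isClosed_orbitSet hmin)
    (isBounded_iff_forall_norm_le.2 ⟨∑ z ∈ D, ‖z‖, ?_⟩)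
  rintro _ ⟨g, z, hz, rfl⟩
  rw [LinearIsometryEquiv.norm_map]
  exact Finset.single_le_sum (f := fun z => ‖z‖) (fun _ _ => norm_nonneg _) hz

theorem isEquivariantModel_zero : IsEquivariantModel S ρ fun _ _ => 0 :=
  ⟨continuousOn_const, fun _ _ g _ => (map_zero (ρ g)).symm⟩

/-- The score of the diffused distribution `ν` at each time. -/
noncomputable def mixtureModel (S : NoiseSchedule) (ν : Measure (EuclideanSpace ℝ (Fin d)))
    (y : EuclideanSpace ℝ (Fin d)) (t : ℝ) : EuclideanSpace ℝ (Fin d) :=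
  mixtureScore ν √(S.α t) (√(1 - S.α t))⁻¹ y

variable {ν : Measure (EuclideanSpace ℝ (Fin d))}

theorem IsOrbitPrior.neZero (hν : IsOrbitPrior ρ D ν) (hD : D.Nonempty) : NeZero ν := by
  obtain ⟨z, hz⟩ := hD
  refine ⟨fun h => hν.measure_ne_zero 1 z hz univ isOpen_univ (mem_univ _) (by simp [h])⟩

theorem continuousOn_comp_schedule {F : Type*} [TopologicalSpace F]
    {φ : ℝ × ℝ × EuclideanSpace ℝ (Fin d) → F} (hφ : Continuous φ) :
    ContinuousOn (fun q : EuclideanSpace ℝ (Fin d) × ℝ =>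
      φ (√(S.α q.2), (√(1 - S.α q.2))⁻¹, q.1)) (univ ×ˢ Ioo 0 S.T) := by
  have hα : ContinuousOn (fun q : EuclideanSpace ℝ (Fin d) × ℝ => S.α q.2) (univ ×ˢ Ioo 0 S.T) :=
    S.continuousOn_Ioo.comp continuousOn_snd fun _ h => h.2
  refine hφ.comp_continuousOn (hα.sqrt.prodMk (ContinuousOn.prodMk ?_ continuousOn_fst))
  exact (continuousOn_const.sub hα).sqrt.inv₀ fun q hq => (S.sqrt_pos hq.2).ne'

theorem isEquivariantModel_mixtureModel (hmin : ∀ y, ∃ z, IsNearest (orbitSet ρ D) y z)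
    (hν : IsOrbitPrior ρ D ν) (hD : D.Nonempty) :
    IsEquivariantModel S ρ (mixtureModel S ν) := by
  have := hν.finite
  have := hν.neZero hD
  exact ⟨continuousOn_comp_schedule (continuous_mixtureScore (isCompact_orbitSet hmin) hν.ae_mem),
    fun t _ g y => mixtureScore_map (ρ g) (hν.map_eq g) _ _ y⟩

/-- By continuity the model is equivariant under the closed group too, so its loss is invariant
under that group and the sum over `D` becomes an integral over `ν`. The factor `1 / D.card` stays
because `ν` is not normalized. -/
theorem trainingLoss_eq_lintegral_noiseLoss (hν : IsOrbitPrior ρ D ν)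
    (hf : IsEquivariantModel S ρ f) :
    trainingLoss S D f = (ENNReal.ofReal S.T)⁻¹ * ∫⁻ t in Ioo 0 S.T, (D.card : ℝ≥0∞)⁻¹ *
      ∫⁻ x, noiseLoss √(S.α t) √(1 - S.α t) (fun y => f y t) x ∂ν := by
  rw [trainingLoss, setLIntegral_congr Ioo_ae_eq_Icc.symm]
  congr 1
  refine setLIntegral_congr_fun measurableSet_Ioo fun t ht => ?_
  simp only
  rw [hν.lintegral_eq _ (measurable_noiseLoss _ _ (hf.continuous ht)) fun u hu x =>
    noiseLoss_map _ _ _ (map_isometryClosure ρ (hf.continuous ht) (hf.equivariant t ht) hu) x]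
  rfl

theorem trainingLoss_zero_lt_top :
    trainingLoss S D (fun _ _ => 0) < ∞ := by
  have h : ∀ t, ∑ z ∈ D, ∫⁻ η,
      ‖-(√(1 - S.α t) • (0 : EuclideanSpace ℝ (Fin d))) - η‖ₑ ^ 2
        ∂(stdGaussian (EuclideanSpace ℝ (Fin d))) =
      D.card * noiseLoss 0 0 (fun _ : EuclideanSpace ℝ (Fin d) => 0) 0 := fun t => by
    rw [← nsmul_eq_mul, ← Finset.sum_const]
    exact Finset.sum_congr rfl fun z _ => noiseLoss_zero_eq (√(S.α t)) _ 0 0 z 0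
  have hlt := noiseLoss_zero_lt_top 0 0 (0 : EuclideanSpace ℝ (Fin d))
  unfold trainingLoss
  simp_rw [h]
  rw [setLIntegral_const]
  refine ENNReal.mul_lt_top (by simp [S.T_pos]) (ENNReal.mul_lt_top ?_ (by simp))
  rw [← mul_assoc]
  exact ENNReal.mul_lt_top (lt_of_le_of_lt (ENNReal.inv_mul_le_one _) ENNReal.one_lt_top) hlt

/-- A function that is continuous and positive at a point of an open time interval has a positive
double integral. -/
theorem lintegral_ofReal_ne_zero {E : Type*} [NormedAddCommGroup E] [MeasurableSpace E]
    [BorelSpace E] {μ : Measure E} [μ.IsOpenPosMeasure] {s : Set ℝ} (hs : IsOpen s)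
    {Q : E × ℝ → ℝ} (hQ : ContinuousOn Q (univ ×ˢ s)) {y : E} {t : ℝ} (ht : t ∈ s)
    (hpos : 0 < Q (y, t)) :
    ∫⁻ t in s, ∫⁻ y, ENNReal.ofReal (Q (y, t)) ∂μ ≠ 0 := by
  have hnhds : ∀ᶠ q in 𝓝 (y, t), Q (y, t) / 2 < Q q ∧ q.2 ∈ s :=
    ((hQ.continuousAt ((isOpen_univ.prod hs).mem_nhds ⟨mem_univ _, ht⟩)).eventually_const_lt
      (half_lt_self hpos)).and (continuousAt_snd.eventually (hs.mem_nhds ht))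
  obtain ⟨U, V, hU, hyU, hV, htV, hUV⟩ := mem_nhds_prod_iff'.1 hnhds
  have hVs : V ⊆ s := fun t' ht' => (hUV (mk_mem_prod hyU ht')).2
  have hlow : ∫⁻ _ in V, ENNReal.ofReal (Q (y, t) / 2) * μ U ≤
      ∫⁻ t in s, ∫⁻ y, ENNReal.ofReal (Q (y, t)) ∂μ := by
    refine (setLIntegral_mono' hV.measurableSet fun t' ht' => ?_).trans (lintegral_mono_set hVs)
    rw [← setLIntegral_const]
    exact (setLIntegral_mono' hU.measurableSet fun y' hy' =>
      ENNReal.ofReal_le_ofReal (hUV (mk_mem_prod hy' ht')).1.le).trans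
        (setLIntegral_le_lintegral _ _)
  refine fun h0 => ?_
  rw [h0, setLIntegral_const, nonpos_iff_eq_zero, mul_eq_zero, mul_eq_zero,
    ENNReal.ofReal_eq_zero] at hlow
  rcases hlow with (h | h) | h
  · linarith
  · exact hU.measure_ne_zero μ ⟨y, hyU⟩ h
  · exact hV.measure_ne_zero volume ⟨t, htV⟩ h

theorem IsTrained.eq_mixtureModel (hmin : ∀ y, ∃ z, IsNearest (orbitSet ρ D) y z)
    (hν : IsOrbitPrior ρ D ν) (hD : D.Nonempty) (hf : IsTrained S ρ D f)
    {t : ℝ} (ht : t ∈ Ioo 0 S.T) (y : EuclideanSpace ℝ (Fin d)) :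
    f y t = mixtureModel S ν y t := by
  have := hν.finite
  have := hν.neZero hD
  have hK := isCompact_orbitSet hmin
  obtain ⟨k, hk, hgauss⟩ := exists_stdGaussian_eq_withDensity (EuclideanSpace ℝ (Fin d))
  have hm : IsEquivariantModel S ρ (mixtureModel S ν) :=
    isEquivariantModel_mixtureModel hmin hν hD
  set Q : EuclideanSpace ℝ (Fin d) × ℝ → ℝ := fun q =>
    k * (√(1 - S.α q.2) ^ Module.finrank ℝ (EuclideanSpace ℝ (Fin d)))⁻¹ *
      (√(1 - S.α q.2) ^ 2 * ‖f q.1 q.2 - mixtureModel S ν q.1 q.2‖ ^ 2 *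
        evidence ν √(S.α q.2) (√(1 - S.α q.2))⁻¹ q.1) with hQ
  have hα : ContinuousOn (fun q : EuclideanSpace ℝ (Fin d) × ℝ => S.α q.2) (univ ×ˢ Ioo 0 S.T) :=
    S.continuousOn_Ioo.comp continuousOn_snd fun _ h => h.2
  have hσ := (continuousOn_const (c := (1 : ℝ)).sub hα).sqrt
  have hQc : ContinuousOn Q (univ ×ˢ Ioo 0 S.T) :=
    (continuousOn_const.mul ((hσ.pow _).inv₀ fun q hq => (pow_pos (S.sqrt_pos hq.2) _).ne')).mul
      (((hσ.pow 2).mul ((hf.1.cont.sub hm.cont).norm.pow 2)).mul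
        (continuousOn_comp_schedule (continuous_evidence hK hν.ae_mem)))
  -- Equality is not needed: superadditivity of the lower integral gives this direction without
  -- measurability in time.
  have hsplit : trainingLoss S D (mixtureModel S ν) + (ENNReal.ofReal S.T)⁻¹ *
      ((D.card : ℝ≥0∞)⁻¹ * ∫⁻ t in Ioo 0 S.T, ∫⁻ y, ENNReal.ofReal (Q (y, t))) ≤
      trainingLoss S D f := by
    rw [trainingLoss_eq_lintegral_noiseLoss hν hf.1, trainingLoss_eq_lintegral_noiseLoss hν hm,
      ← mul_add, ← lintegral_const_mul' _ _ (by simp [hD.ne_empty])]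
    gcongr
    refine (le_lintegral_add _ _).trans_eq
      (setLIntegral_congr_fun measurableSet_Ioo fun s hs => ?_)
    simp only
    rw [← mul_add, lintegral_noiseLoss_eq hK hν.ae_mem hk hgauss _ (S.sqrt_pos hs)
      (hf.1.continuous hs)]
    rfl
  have hfin : trainingLoss S D f ≠ ∞ :=
    ((hf.2 _ isEquivariantModel_zero).trans_lt trainingLoss_zero_lt_top).ne
  have hzero : ∫⁻ t in Ioo 0 S.T, ∫⁻ y, ENNReal.ofReal (Q (y, t)) = 0 := by
    have h1 := hsplit.trans (hf.2 _ hm)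
    -- Cancelling in `ℝ≥0∞` requires the minimal loss to be finite, which comparison with the zero
    -- model provides.
    have hfin' := ne_top_of_le_ne_top hfin (le_self_add.trans hsplit)
    have h2 := ENNReal.le_sub_of_add_le_left hfin' h1
    rw [tsub_self, nonpos_iff_eq_zero] at h2
    simpa using h2
  by_contra hne
  refine lintegral_ofReal_ne_zero isOpen_Ioo hQc ht (y := y) ?_ hzero
  have h1 := S.sqrt_pos ht
  have h2 : 0 < ‖f y t - mixtureModel S ν y t‖ := norm_pos_iff.2 (sub_ne_zero.2 hne)
  have h3 := evidence_pos hK hν.ae_mem √(S.α t) (√(1 - S.α t))⁻¹ y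
  simp only [hQ]
  positivity

end Training

/-! ### The denoising flow near time zero, and its symmetry. -/

section Denoising

variable {d : ℕ} {G : Type*} [Group G] {S : NoiseSchedule}
  {ρ : G →* (EuclideanSpace ℝ (Fin d) ≃ₗᵢ[ℝ] EuclideanSpace ℝ (Fin d))}
  {D : Finset (EuclideanSpace ℝ (Fin d))}
  {f : EuclideanSpace ℝ (Fin d) → ℝ → EuclideanSpace ℝ (Fin d)}
  {y : ℝ → EuclideanSpace ℝ (Fin d)} {p z : EuclideanSpace ℝ (Fin d)}

theorem NoiseSchedule.tendsto_α (S : NoiseSchedule) : Tendsto S.α (𝓝[>] 0) (𝓝 1) := by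
  have h := (S.α_cont 0 ⟨le_rfl, S.T_pos.le⟩).tendsto
  rw [S.α_zero] at h
  exact h.mono_left (nhdsWithin_le_of_mem (Icc_mem_nhdsGT S.T_pos))

theorem NoiseSchedule.tendsto_one_sub_α (S : NoiseSchedule) :
    Tendsto (fun t => 1 - S.α t) (𝓝[>] 0) (𝓝[>] 0) := by
  refine tendsto_nhdsWithin_iff.2 ⟨by simpa using S.tendsto_α.const_sub 1, ?_⟩
  filter_upwards [Ioo_mem_nhdsGT S.T_pos] with t ht
  exact sub_pos.2 (S.α_mem t ht).2

theorem NoiseSchedule.tendsto_inv_sqrt (S : NoiseSchedule) :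
    Tendsto (fun t => (√(1 - S.α t))⁻¹) (𝓝[>] 0) atTop := by
  refine tendsto_inv_nhdsGT_zero.comp (tendsto_nhdsWithin_iff.2 ⟨?_, ?_⟩)
  · simpa using (S.tendsto_one_sub_α.mono_right nhdsWithin_le_nhds).sqrt
  · filter_upwards [Ioo_mem_nhdsGT S.T_pos] with t ht using S.sqrt_pos ht

/-- The logarithm of the noise variance decreases to `-∞` at time `0`, so its derivative
`2 γ α / (1 - α)` is unbounded there. -/
theorem NoiseSchedule.not_eventually_abs_γ_div_le (S : NoiseSchedule) (M : ℝ) :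
    ¬ ∀ᶠ t in 𝓝[>] 0, |S.γ t| / (1 - S.α t) ≤ M := by
  intro hM
  obtain ⟨δ, hδ, hsub⟩ := mem_nhdsGT_iff_exists_Ioo_subset.1
    (hM.and (Ioo_mem_nhdsGT S.T_pos))
  have hδ : 0 < δ := hδ
  have hderiv : ∀ t ∈ Ioo 0 δ, HasDerivWithinAt (fun t => Real.log (1 - S.α t))
      (-(-2 * S.γ t * S.α t) / (1 - S.α t)) (Ioo 0 δ) t := fun t ht =>
    (((S.α_deriv t (hsub ht).2).const_sub 1).log
      (sub_pos.2 (S.α_mem t (hsub ht).2).2).ne').hasDerivWithinAt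
  have hbound : ∀ t ∈ Ioo 0 δ, ‖-(-2 * S.γ t * S.α t) / (1 - S.α t)‖ ≤ 2 * M := fun t ht => by
    obtain ⟨h1, h2⟩ := hsub ht
    obtain ⟨h3, h4⟩ := S.α_mem t h2
    have h5 : 0 < 1 - S.α t := sub_pos.2 h4
    rw [Real.norm_eq_abs, abs_div, abs_of_pos h5, abs_neg, abs_mul, abs_mul, abs_of_pos h3]
    have h6 : 0 ≤ |S.γ t| / (1 - S.α t) := by positivity
    calc |(-2 : ℝ)| * |S.γ t| * S.α t / (1 - S.α t)
        = 2 * (|S.γ t| / (1 - S.α t)) * S.α t := by rw [abs_neg, abs_two]; ring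
      _ ≤ 2 * (|S.γ t| / (1 - S.α t)) * 1 := by gcongr
      _ ≤ 2 * M := by linarith
  have hmid : δ / 2 ∈ Ioo 0 δ := ⟨by linarith, by linarith⟩
  -- A bounded derivative on a bounded interval keeps `log (1 - α)` bounded below, contrary to `1 -
  -- α → 0`.
  have hlip : ∀ t ∈ Ioo 0 δ,
      Real.log (1 - S.α (δ / 2)) - 2 * M * δ ≤ Real.log (1 - S.α t) := fun t ht => by
    have h1 := (convex_Ioo 0 δ).norm_image_sub_le_of_norm_hasDerivWithin_le hderiv hbound hmid ht
    have h2 : 0 ≤ 2 * M := (norm_nonneg _).trans (hbound t ht)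
    have h3 : ‖t - δ / 2‖ ≤ δ := by
      rw [Real.norm_eq_abs, abs_le]
      constructor <;> linarith [ht.1, ht.2]
    have h4 := h1.trans (mul_le_mul_of_nonneg_left h3 h2)
    rw [Real.norm_eq_abs] at h4
    linarith [(abs_le.1 h4).1]
  have hlog := Real.tendsto_log_nhdsGT_zero.comp S.tendsto_one_sub_α
  obtain ⟨t, h1, h2⟩ := ((hlog.eventually_lt_atBot
    (Real.log (1 - S.α (δ / 2)) - 2 * M * δ)).and (Ioo_mem_nhdsGT hδ)).exists
  exact absurd (hlip t h2) (not_le.2 h1)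

/-- Isolates the singular factor `γ / (1 - α)`; what it multiplies has a limit at time `0`. -/
theorem mixtureModel_flow (ν : Measure (EuclideanSpace ℝ (Fin d))) {t : ℝ} (ht : t ∈ Ioo 0 S.T)
    (x : EuclideanSpace ℝ (Fin d)) :
    S.γ t • (x + mixtureModel S ν x t) = (S.γ t / (1 - S.α t)) •
      (√(S.α t) • posteriorMean ν √(S.α t) (√(1 - S.α t))⁻¹ x - S.α t • x) := by
  have h1 : 0 < 1 - S.α t := sub_pos.2 (S.α_mem t ht).2
  rw [mixtureModel, mixtureScore, inv_pow, Real.sq_sqrt h1.le, div_eq_mul_inv, mul_smul]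
  congr 1
  have h2 : x = (1 - S.α t)⁻¹ • ((1 - S.α t) • x) := by rw [inv_smul_smul₀ h1.ne']
  nth_rw 1 [h2]
  rw [← smul_add]
  congr 1
  module

/-- A denoising trajectory of a trained model with bounded derivative ends at the nearest point of
the augmented dataset, if that point is unique. -/
theorem endpoint_eq_nearest (hmin : ∀ y, ∃ z, IsNearest (orbitSet ρ D) y z)
    (hf : IsTrained S ρ D f) (hy : IsTrajectory S f y) {C : ℝ}
    (hC : ∀ t ∈ Ioo 0 S.T, ‖deriv y t‖ ≤ C) (hp : EndsAt y p)
    (hz : IsNearest (orbitSet ρ D) p z) (huniq : ∀ w, IsNearest (orbitSet ρ D) p w → w = z) :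
    p = z := by
  obtain ⟨ν, hν⟩ := exists_isOrbitPrior ρ D (isClosed_orbitSet hmin)
  have hD : D.Nonempty := by
    obtain ⟨_, _, h, _⟩ := hz.1
    exact ⟨_, h⟩
  have := hν.finite
  have hmean : Tendsto (fun t => posteriorMean ν √(S.α t) (√(1 - S.α t))⁻¹ (y t)) (𝓝[>] 0)
      (𝓝 z) := by
    refine tendsto_posteriorMean (isCompact_orbitSet hmin) hν.ae_mem ?_ ?_ ?_
      S.tendsto_inv_sqrt hp
    · obtain ⟨g, x, hx, rfl⟩ := hz.1
      exact hν.measure_ne_zero g x hx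
    · exact fun x hx hle => huniq x ⟨hx, fun w hw => hle.trans (hz.2 w hw)⟩
    · simpa using S.tendsto_α.sqrt
  have hdrift : Tendsto (fun t => √(S.α t) • posteriorMean ν √(S.α t) (√(1 - S.α t))⁻¹ (y t)
      - S.α t • y t) (𝓝[>] 0) (𝓝 (z - p)) := by
    simpa using (S.tendsto_α.sqrt.smul hmean).sub (S.tendsto_α.smul hp)
  by_contra hne
  have hv : 0 < ‖z - p‖ := norm_pos_iff.2 (sub_ne_zero.2 (Ne.symm hne))
  -- Near time `0` the nonsingular factor of the velocity has norm above `‖z - p‖ / 2`, so a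
  -- velocity bounded by `C` would bound the singular factor by this quotient.
  refine S.not_eventually_abs_γ_div_le (C / (‖z - p‖ / 2)) ?_
  filter_upwards [hdrift.norm.eventually_const_lt (half_lt_self hv), Ioo_mem_nhdsGT S.T_pos]
    with t hlt ht
  have h1 := hC t ht
  have h2 : 0 < 1 - S.α t := sub_pos.2 (S.α_mem t ht).2
  rw [(hy.flow t ht).deriv, hf.eq_mixtureModel hmin hν hD ht, mixtureModel_flow ν ht, norm_neg,
    norm_smul, Real.norm_eq_abs, abs_div, abs_of_pos h2] at h1
  rw [le_div_iff₀ (half_pos hv)]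
  exact (mul_le_mul_of_nonneg_left hlt.le (by positivity)).trans h1

theorem IsRegular.exists_endsAt (hmin : ∀ y, ∃ z, IsNearest (orbitSet ρ D) y z)
    (hf : IsTrained S ρ D f) (hy : IsTrajectory S f y) (hr : IsRegular S (orbitSet ρ D) y) :
    ∃ p ∈ orbitSet ρ D, EndsAt y p := by
  obtain ⟨⟨C, hC⟩, p, hp, z, hz, huniq⟩ := hr
  obtain rfl := endpoint_eq_nearest hmin hf hy hC hp hz huniq
  exact ⟨p, hz.1, hp⟩

theorem EndsAt.mem_orbitSet (hmin : ∀ y, ∃ z, IsNearest (orbitSet ρ D) y z)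
    (hf : IsTrained S ρ D f) (hy : IsTrajectory S f y) (hr : IsRegular S (orbitSet ρ D) y)
    (hp : EndsAt y p) : p ∈ orbitSet ρ D := by
  obtain ⟨p', hp', hy'⟩ := hr.exists_endsAt hmin hf hy
  rwa [tendsto_nhds_unique hp hy']

theorem IsTrajectory.map (hf : IsEquivariantModel S ρ f) (hy : IsTrajectory S f y) (g : G) :
    IsTrajectory S f fun t => ρ g (y t) where
  cont := (ρ g).continuous.comp_continuousOn hy.cont
  flow t ht := by
    rw [hf.equivariant t ht, ← map_add, ← map_smul, ← map_neg]
    exact (ρ g).toContinuousLinearEquiv.toContinuousLinearMap.hasFDerivAt.comp_hasDerivAt t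
      (hy.flow t ht)

theorem existsUnique_isNearest_of_mem {O : Set (EuclideanSpace ℝ (Fin d))} (hp : p ∈ O) :
    ∃! z, IsNearest O p z := by
  refine ⟨p, ⟨hp, fun w _ => by simp⟩, fun w hw => ?_⟩
  have := hw.2 p hp
  rw [dist_self] at this
  exact (dist_le_zero.1 this).symm

/-- Isometries preserve the bound on the derivative, and uniqueness of the nearest point is
automatic at an endpoint in `G(D)`. -/
theorem orbitSet_subset_regularEndpoints (hf : IsEquivariantModel S ρ f)
    (h : ∀ z ∈ D, z ∈ regularEndpoints S (orbitSet ρ D) f) :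
    orbitSet ρ D ⊆ regularEndpoints S (orbitSet ρ D) f := by
  rintro _ ⟨g, z, hz, rfl⟩
  obtain ⟨y, hy, ⟨⟨C, hC⟩, -⟩, hyz⟩ := h z hz
  have hend : EndsAt (fun t => ρ g (y t)) (ρ g z) := ((ρ g).continuous.tendsto z).comp hyz
  refine ⟨_, hy.map hf g, ⟨⟨C, fun t ht => ?_⟩, _, hend,
    existsUnique_isNearest_of_mem ⟨g, z, hz, rfl⟩⟩, hend⟩
  have h1 := hC t ht
  rw [(hy.flow t ht).deriv] at h1
  rw [((hy.map hf g).flow t ht).deriv, hf.equivariant t ht, ← map_add, ← map_smul, ← map_neg,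
    LinearIsometryEquiv.norm_map]
  exact h1

theorem orbitSet_subset_predictionSpace (hf : IsEquivariantModel S ρ f) (h : DataFixed S D f) :
    orbitSet ρ D ⊆ predictionSpace S f := by
  rintro _ ⟨g, z, hz, rfl⟩
  -- By equivariance `ρ g z` is also a zero of the vector field, so the constant trajectory works.
  refine ⟨fun _ => ρ g z, ⟨continuousOn_const, fun t ht => ?_⟩, tendsto_const_nhds⟩
  rw [hf.equivariant t ht, ← map_add, h z hz t ht, map_zero, smul_zero, neg_zero]
  exact hasDerivAt_const t _

end Denoising

end Diffusion
theorem theorem2 {d : ℕ} {G : Type*} [Group G] (S : Diffusion.NoiseSchedule)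
    (ρ : G →* (EuclideanSpace ℝ (Fin d) ≃ₗᵢ[ℝ] EuclideanSpace ℝ (Fin d)))
    (D : Finset (EuclideanSpace ℝ (Fin d)))
    (hmin : ∀ y, ∃ z, Diffusion.IsNearest (Diffusion.orbitSet ρ D) y z)
    (f : EuclideanSpace ℝ (Fin d) → ℝ → EuclideanSpace ℝ (Fin d))
    (hf : Diffusion.IsEquivariantModel S ρ f) :
    -- a trained model sends every regular trajectory into `G(D)`
    (Diffusion.IsTrained S ρ D f →
      ∀ y, Diffusion.IsTrajectory S f y → Diffusion.IsRegular S (Diffusion.orbitSet ρ D) y →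
        ∃ p ∈ Diffusion.orbitSet ρ D, Diffusion.EndsAt y p) ∧
    -- if the data are fixed points, then every point of `G(D)` is reached (trained or not)
    (Diffusion.DataFixed S D f →
      Diffusion.orbitSet ρ D ⊆ Diffusion.predictionSpace S f) ∧
    -- hence the equality `Ω_f = G(D)`
    (Diffusion.IsTrained S ρ D f →
      (∀ y, Diffusion.IsTrajectory S f y → Diffusion.IsRegular S (Diffusion.orbitSet ρ D) y) →
      Diffusion.DataFixed S D f →
        Diffusion.predictionSpace S f = Diffusion.orbitSet ρ D) ∧
    -- the same for regular trajectories, with data points that are merely reached by such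
    (Diffusion.IsTrained S ρ D f →
      (∀ z ∈ D, z ∈ Diffusion.regularEndpoints S (Diffusion.orbitSet ρ D) f) →
        Diffusion.regularEndpoints S (Diffusion.orbitSet ρ D) f = Diffusion.orbitSet ρ D) := by
  refine ⟨fun ht y hy hr => hr.exists_endsAt hmin ht hy,
    Diffusion.orbitSet_subset_predictionSpace hf, fun ht hreg hfix => ?_, fun ht hreach => ?_⟩
  · refine Subset.antisymm ?_ (Diffusion.orbitSet_subset_predictionSpace hf hfix)
    rintro p ⟨y, hy, hp⟩
    exact hp.mem_orbitSet hmin ht hy (hreg y hy)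
  · refine Subset.antisymm ?_ (Diffusion.orbitSet_subset_regularEndpoints hf hreach)
    rintro p ⟨y, hy, hr, hp⟩
    exact hp.mem_orbitSet hmin ht hy hr
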